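/- Let $0<T<\infty$, $a,b\in\mathbb R$, and let $B=(B_t)_{t\in[0,T]}$ be a one-dimensional standard Brownian motion started at $0$, with almost surely continuous paths, on a probability space $(\Omega,\mathcal F,\mu)$. Let \[ X_t:=a\Bigl(1-\frac tT\Bigr)+b\,\frac tT+B_t-\frac tT B_T,\qquad 0\le t\le T, \] be the associated Brownian bridge from $a$ to $b$ on $[0,T]$. For $\varepsilon>0$ let $p_\varepsilon(x)=\frac1{\sqrt{2\pi\varepsilon}}\exp\bigl(-\frac{x^2}{2\varepsilon}\bigr)$, $x\in\mathbb R$, be the heat kernel and let \[ \mathcal I_\varepsilon:=\int_0^T\int_0^t p_\varepsilon(X_t-X_s)\,ds\,dt \] be the approximated self-intersection local time of $X$. Then $\mathcal I_\varepsilon\in L^2(\mu)$ for every $\varepsilon>0$, and $\mathcal I_\varepsilon$ converges in $L^2(\mu)$ as $\varepsilon\downarrow0$; that is, there is $\mathcal I\in L^2(\mu)$ with $\lim_{\varepsilon\downarrow0}\|\mathcal I_\varepsilon-\mathcal I\|_{L^2(\mu)}=0$. -/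

import Mathlib

open MeasureTheory ProbabilityTheory Filter Topology
open scoped NNReal

/-- `B` restricted to the time interval `[0, T]` is a one-dimensional standard Brownian motion
started at `0`: its finite-dimensional distributions at times in `[0, T]` are those of Brownian
motion (`ProbabilityTheory.BrownianReal.projectiveFamily`), and almost every path is continuous
on `[0, T]`. The values of `B` at times outside `[0, T]` play no role. -/
structure IsBrownianMotionOn {Ω : Type*} [MeasurableSpace Ω] (T : ℝ) (B : ℝ → Ω → ℝ)
    (μ : Measure Ω) : Prop where
  hasLaw : ∀ I : Finset ℝ≥0, (∀ t ∈ I, (t : ℝ) ≤ T) →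
    HasLaw (fun ω (t : I) ↦ B ((t : ℝ≥0) : ℝ) ω) (BrownianReal.projectiveFamily I) μ
  continuousOn : ∀ᵐ ω ∂μ, ContinuousOn (fun t ↦ B t ω) (Set.Icc 0 T)

/-- A Brownian motion on `[0, ∞)` is a Brownian motion on every `[0, T]`. -/
theorem IsBrownianMotionOn.of_isBrownianReal {Ω : Type*} [MeasurableSpace Ω] {μ : Measure Ω}
    {W : ℝ≥0 → Ω → ℝ} (hW : IsBrownianReal W μ) (T : ℝ) :
    IsBrownianMotionOn T (fun t ↦ W t.toNNReal) μ where
  hasLaw I _ := by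
    have h := hW.toIsPreBrownianReal.hasLaw I
    simp only [Real.toNNReal_coe]
    exact h
  continuousOn := by
    filter_upwards [hW.cont] with ω hω
    exact (hω.comp continuous_real_toNNReal).continuousOn

/-- The Brownian bridge from `a` to `b` on `[0, T]` built from the Brownian motion `B`:
`X_t = a (1 - t/T) + b t/T + B_t - (t/T) B_T`. -/
noncomputable def brownianBridge {Ω : Type*} (T a b : ℝ) (B : ℝ → Ω → ℝ) (t : ℝ) (ω : Ω) : ℝ :=
  a * (1 - t / T) + b * (t / T) + B t ω - t / T * B T ω

/-- The heat kernel `p_ε(x) = (2πε)^{-1/2} exp(-x²/(2ε))`. -/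
noncomputable def heatKernel (ε x : ℝ) : ℝ :=
  1 / √(2 * Real.pi * ε) * Real.exp (-x ^ 2 / (2 * ε))

/-- The approximated self-intersection local time `∫_0^T ∫_0^t p_ε(X_t - X_s) ds dt` of a real
process `X` on `[0, T]`. -/
noncomputable def approxSelfIntersectionLocalTime {Ω : Type*} (T : ℝ) (X : ℝ → Ω → ℝ) (ε : ℝ)
    (ω : Ω) : ℝ :=
  ∫ t in (0 : ℝ)..T, ∫ s in (0 : ℝ)..t, heatKernel ε (X t ω - X s ω)

/-! Fourier inversion gives p_ε(x) = (2π)⁻¹ ∫ exp(-εy²/2) cos(yx) dy. The integrand p_ε(X_t - X_s)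
is symmetric in (s, t), so the triangle carries half of the square, and I_ε = (4π)⁻¹ ∫ exp(-εy²/2)
M(y) dy with M(y) = |∫_0^T exp(iyX_t) dt|² ≥ 0 (`pathEnergy`). The natural limit is (4π)⁻¹ ∫ M(y)
dy, and dominated convergence yields it in L² as soon as ∫ M(y) dy lies in L²(μ).

By Cauchy–Schwarz with weight 1 + y², it is enough that E M(y)² is bounded and O(y⁻⁴). Expanding the
square, E M(y)² is the integral over [0,T]⁴ of the characteristic function of X_{t₁} - X_{t₂} +
X_{t₃} - X_{t₄}, whose modulus is exp(-y²V/2) with V the variance; the endpoints a and b affect only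
its phase.

The key estimate is `exp_neg_bridgeVariance_le`. The four times cut a circle of length T into four
arcs; if q is the total length of two suitable opposite arcs, then V ≥ q(T - q)/T ≥ min(q, T - q)/2.
Hence exp(-y²V/2) is at most a product of two kernels exp(-(y²/4) d), d the circle distance, for one
pairing of the four points. Summing over all three pairings makes the bound independent of the order
of the times, and each pairing integrates to O(y⁻⁴). -/

/-! ### Gaussian laws and characteristic functions of Brownian motion -/

section BrownianLaw

variable {Ω : Type*} [MeasurableSpace Ω] {μ : Measure Ω} {T : ℝ} {B : ℝ → Ω → ℝ}

namespace IsBrownianMotionOn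

/-- The times may repeat, so the vector is obtained as a linear image of the values at the distinct
times in the range of `w`. -/
theorem hasGaussianLaw (hB : IsBrownianMotionOn T B μ) {ι : Type*} [Fintype ι] (w : ι → ℝ≥0)
    (hw : ∀ i, (w i : ℝ) ≤ T) : HasGaussianLaw (fun ω i ↦ B (w i) ω) μ := by
  classical
  have h := (hB.hasLaw (Finset.univ.image w) (by simpa using hw)).hasGaussianLaw
  exact h.map_fun (ContinuousLinearMap.pi fun i ↦
    ContinuousLinearMap.proj (⟨w i, by simp⟩ : (Finset.univ.image w : Finset ℝ≥0)))

theorem hasGaussianLaw_eval (hB : IsBrownianMotionOn T B μ) (s : ℝ≥0) (hs : (s : ℝ) ≤ T) :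
    HasGaussianLaw (B s) μ :=
  (hB.hasGaussianLaw (fun _ : Unit ↦ s) (fun _ ↦ hs)).eval ()

theorem covariance_eval (hB : IsBrownianMotionOn T B μ) (s t : ℝ≥0) (hs : (s : ℝ) ≤ T)
    (ht : (t : ℝ) ≤ T) : cov[B s, B t; μ] = min s t := by
  convert (hB.hasLaw {s, t} (by simp [hs, ht])).covariance_fun_comp
    (f := Function.eval ⟨s, by simp⟩) (g := fun x ↦ x ⟨t, by simp⟩) ?_ ?_
  · exact (BrownianReal.covariance_eval_projectiveFamily {s, t} ⟨s, by simp⟩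
      ⟨t, by simp⟩).symm
  all_goals exact Measurable.aemeasurable (by fun_prop)

/-- The modulus of the characteristic function of a linear combination of values of a Brownian
motion, shifted by a constant. -/
theorem norm_integral_cexp [IsProbabilityMeasure μ] (hB : IsBrownianMotionOn T B μ) {ι : Type*}
    [Fintype ι] (w : ι → ℝ≥0) (hw : ∀ i, (w i : ℝ) ≤ T) (c : ι → ℝ) (m y : ℝ) :
    ‖∫ ω, Complex.exp ((y * (m + ∑ i, c i * B (w i) ω) : ℝ) * Complex.I) ∂μ‖ =
      Real.exp (-(y ^ 2 / 2 * ∑ i, ∑ j, c i * c j * min (w i : ℝ) (w j))) := by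
  have hmem (i : ι) : MemLp (fun ω ↦ c i * B (w i) ω) 2 μ :=
    ((hB.hasGaussianLaw_eval (w i) (hw i)).memLp_two).const_mul _
  have hN : HasGaussianLaw (fun ω ↦ ∑ i, c i * B (w i) ω) μ := by
    have := (hB.hasGaussianLaw w hw).map_fun
      (∑ i, c i • ContinuousLinearMap.proj (R := ℝ) (φ := fun _ : ι ↦ ℝ) i)
    simpa using this
  have hvar : Var[fun ω ↦ ∑ i, c i * B (w i) ω; μ] =
      ∑ i, ∑ j, c i * c j * min (w i : ℝ) (w j) := by
    rw [variance_fun_sum hmem]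
    refine Finset.sum_congr rfl fun i _ ↦ Finset.sum_congr rfl fun j _ ↦ ?_
    rw [covariance_const_mul_left, covariance_const_mul_right]
    have := hB.covariance_eval (w i) (w j) (hw i) (hw j)
    rw [this]
    push_cast
    ring
  have hchar := hN.charFun_map_eq y
  rw [charFun_apply_real, integral_map hN.aemeasurable (by fun_prop)] at hchar
  -- The deterministic shift `m` contributes only a factor of modulus one.
  have hsplit : ∫ ω, Complex.exp ((y * (m + ∑ i, c i * B (w i) ω) : ℝ) * Complex.I) ∂μ =
      Complex.exp ((y * m : ℝ) * Complex.I) *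
        ∫ ω, Complex.exp (y * ((∑ i, c i * B (w i) ω : ℝ) : ℂ) * Complex.I) ∂μ := by
    rw [← integral_const_mul]
    refine integral_congr_ae (.of_forall fun ω ↦ ?_)
    simp only
    rw [← Complex.exp_add]
    push_cast
    ring_nf
  rw [hsplit, norm_mul, Complex.norm_exp_ofReal_mul_I, one_mul, hchar, Complex.norm_exp, ← hvar]
  have hv : Var[fun ω ↦ inner ℝ y (∑ i, c i * B (w i) ω); μ] =
      y ^ 2 * Var[fun ω ↦ ∑ i, c i * B (w i) ω; μ] := by
    rw [← variance_const_mul]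
    simp [mul_comm]
  rw [hv]
  simp only [Complex.sub_re, Complex.mul_re, Complex.ofReal_re, Complex.ofReal_im, Complex.I_re,
    Complex.I_im, mul_zero, zero_mul, sub_zero, zero_sub, ← Complex.ofReal_ofNat,
    ← Complex.ofReal_div]
  ring_nf

end IsBrownianMotionOn

end BrownianLaw

/-! ### Variance bound and kernel estimates on the circle -/

section CircleDist

/-- The distance of `s` and `t` on the circle of length `T`. -/
noncomputable def circleDist (T s t : ℝ) : ℝ := min |s - t| (T - |s - t|)

theorem circleDist_comm (T s t : ℝ) : circleDist T s t = circleDist T t s := by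
  simp [circleDist, abs_sub_comm]

/-- The kernel `exp (-k d(s, t))` of the distance `d` on the circle of length `T`. -/
noncomputable def circleKernel (T k s t : ℝ) : ℝ := Real.exp (-(k * circleDist T s t))

theorem circleKernel_comm (T k s t : ℝ) : circleKernel T k s t = circleKernel T k t s := by
  simp [circleKernel, circleDist_comm]

@[fun_prop]
theorem continuous_circleKernel (T k : ℝ) :
    Continuous fun p : ℝ × ℝ ↦ circleKernel T k p.1 p.2 := by
  unfold circleKernel circleDist
  fun_prop

theorem circleKernel_nonneg (T k s t : ℝ) : 0 ≤ circleKernel T k s t := (Real.exp_pos _).le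

/-- The sum over the three pairings of four points of the products of their kernels. -/
noncomputable def pairingKernel (T k t₁ t₂ t₃ t₄ : ℝ) : ℝ :=
  circleKernel T k t₁ t₂ * circleKernel T k t₃ t₄ +
    circleKernel T k t₁ t₄ * circleKernel T k t₃ t₂ +
    circleKernel T k t₁ t₃ * circleKernel T k t₂ t₄

/-- With q the length of two opposite arcs, the larger of q and T - q is at least T/2, so `hV`
bounds the smaller by 2V. If it is q, the arcs [t₁, t₂] and [t₃, t₄] give the pairing; if it is T -
q, the arc [t₂, t₃] and the one through 0 ≡ T do. -/
theorem exp_neg_le_pairingKernel_of_sorted {T k t₁ t₂ t₃ t₄ V : ℝ} (hT : 0 < T) (hk : 0 ≤ k)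
    (h12 : t₁ ≤ t₂) (h23 : t₂ ≤ t₃) (h34 : t₃ ≤ t₄)
    (hV : (t₂ - t₁ + (t₄ - t₃)) * (T - (t₂ - t₁ + (t₄ - t₃))) ≤ T * V)
    (h1 : 0 ≤ t₁) (h4 : t₄ ≤ T) :
    Real.exp (-(2 * k * V)) ≤ pairingKernel T k t₁ t₂ t₃ t₄ := by
  have e12 : |t₁ - t₂| = t₂ - t₁ := by rw [abs_of_nonpos] <;> linarith
  have e34 : |t₃ - t₄| = t₄ - t₃ := by rw [abs_of_nonpos] <;> linarith
  have e14 : |t₁ - t₄| = t₄ - t₁ := by rw [abs_of_nonpos] <;> linarith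
  have e32 : |t₃ - t₂| = t₃ - t₂ := by rw [abs_of_nonneg]; linarith
  have hnn := circleKernel_nonneg T k
  have a := mul_nonneg (hnn t₁ t₂) (hnn t₃ t₄)
  have b := mul_nonneg (hnn t₁ t₄) (hnn t₃ t₂)
  have c := mul_nonneg (hnn t₁ t₃) (hnn t₂ t₄)
  set q := t₂ - t₁ + (t₄ - t₃) with hq
  rcases le_total q (T - q) with h | h
  · have hVq : q ≤ 2 * V := by nlinarith
    have : Real.exp (-(2 * k * V)) ≤ circleKernel T k t₁ t₂ * circleKernel T k t₃ t₄ := by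
      rw [circleKernel, circleKernel, ← Real.exp_add, Real.exp_le_exp]
      have l1 : circleDist T t₁ t₂ ≤ t₂ - t₁ := (min_le_left _ _).trans e12.le
      have l2 : circleDist T t₃ t₄ ≤ t₄ - t₃ := (min_le_left _ _).trans e34.le
      nlinarith
    unfold pairingKernel
    linarith
  · have hVq : T - q ≤ 2 * V := by nlinarith
    have : Real.exp (-(2 * k * V)) ≤ circleKernel T k t₁ t₄ * circleKernel T k t₃ t₂ := by
      rw [circleKernel, circleKernel, ← Real.exp_add, Real.exp_le_exp]
      have l1 : circleDist T t₁ t₄ ≤ T - (t₄ - t₁) := (min_le_right _ _).trans (by rw [e14])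
      have l2 : circleDist T t₃ t₂ ≤ t₃ - t₂ := (min_le_left _ _).trans e32.le
      nlinarith
    unfold pairingKernel
    linarith

/-- The variance of `X t₁ - X t₂ + X t₃ - X t₄` for a Brownian bridge `X` on `[0, T]`. -/
noncomputable def bridgeVariance (T t₁ t₂ t₃ t₄ : ℝ) : ℝ :=
  |t₁ - t₂| + |t₁ - t₄| + |t₃ - t₂| + |t₃ - t₄| - |t₁ - t₃| - |t₂ - t₄| -
    (t₁ - t₂ + t₃ - t₄) ^ 2 / T

/-- Both sides are invariant under t₁ ↔ t₃, under t₂ ↔ t₄, and under exchanging the two pairs (a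
global sign change). This leaves three orderings, and in each V ≥ q(T - q)/T, where q adds the first
and last gaps of the sorted times. -/
theorem exp_neg_bridgeVariance_le {T k t₁ t₂ t₃ t₄ : ℝ} (hT : 0 < T) (hk : 0 ≤ k)
    (h₁ : t₁ ∈ Set.Icc 0 T) (h₂ : t₂ ∈ Set.Icc 0 T) (h₃ : t₃ ∈ Set.Icc 0 T)
    (h₄ : t₄ ∈ Set.Icc 0 T) :
    Real.exp (-(2 * k * bridgeVariance T t₁ t₂ t₃ t₄)) ≤ pairingKernel T k t₁ t₂ t₃ t₄ := by
  wlog h13 : t₁ ≤ t₃ generalizing t₁ t₃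
  · convert this h₃ h₁ (not_le.1 h13).le using 1
    · unfold bridgeVariance
      rw [abs_sub_comm t₁ t₃]
      ring_nf
    · unfold pairingKernel
      rw [circleKernel_comm T k t₁ t₃]
      ring
  wlog h24 : t₂ ≤ t₄ generalizing t₂ t₄
  · convert this h₄ h₂ (not_le.1 h24).le using 1
    · unfold bridgeVariance
      rw [abs_sub_comm t₂ t₄]
      ring_nf
    · unfold pairingKernel
      rw [circleKernel_comm T k t₂ t₄]
      ring
  wlog h12 : t₁ ≤ t₂ generalizing t₁ t₂ t₃ t₄
  · convert this h₂ h₄ h24 h₁ h₃ h13 (not_le.1 h12).le using 1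
    · unfold bridgeVariance
      rw [abs_sub_comm t₁ t₂, abs_sub_comm t₁ t₄, abs_sub_comm t₃ t₂, abs_sub_comm t₃ t₄]
      ring_nf
    · unfold pairingKernel
      rw [circleKernel_comm T k t₁ t₂, circleKernel_comm T k t₁ t₄, circleKernel_comm T k t₃ t₂,
        circleKernel_comm T k t₃ t₄]
      ring
  have hTV (u : ℝ) : T * (u - (t₁ - t₂ + t₃ - t₄) ^ 2 / T) = T * u - (t₁ - t₂ + t₃ - t₄) ^ 2 := by
    field_simp
  have e12 : |t₁ - t₂| = t₂ - t₁ := by rw [abs_of_nonpos] <;> linarith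
  have e13 : |t₁ - t₃| = t₃ - t₁ := by rw [abs_of_nonpos] <;> linarith
  have e24 : |t₂ - t₄| = t₄ - t₂ := by rw [abs_of_nonpos] <;> linarith
  have e14 : |t₁ - t₄| = t₄ - t₁ := by rw [abs_of_nonpos] <;> linarith
  have h1 := h₁.1
  have h3T := h₃.2
  have h4T := h₄.2
  rcases le_total t₃ t₂ with h32 | h23
  · have e32 : |t₃ - t₂| = t₂ - t₃ := by rw [abs_of_nonpos] <;> linarith
    have e34 : |t₃ - t₄| = t₄ - t₃ := by rw [abs_of_nonpos] <;> linarith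
    -- Signs + + - -: TV - q(T - q) = 4(t₂ - t₃)(T - (t₄ - t₁)) ≥ 0.
    have := exp_neg_le_pairingKernel_of_sorted (V := bridgeVariance T t₁ t₂ t₃ t₄) hT hk h13 h32 h24
      (by
        rw [bridgeVariance, hTV, e12, e13, e24, e14, e32, e34]
        nlinarith [mul_nonneg (sub_nonneg.2 h32) (sub_nonneg.2 h1),
          mul_nonneg (sub_nonneg.2 h32) (sub_nonneg.2 h4T)]) h1 h4T
    refine this.trans_eq ?_
    unfold pairingKernel
    rw [circleKernel_comm T k t₂ t₃]
    ring
  · have e32 : |t₃ - t₂| = t₃ - t₂ := by rw [abs_of_nonneg]; linarith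
    rcases le_total t₃ t₄ with h34 | h43
    · have e34 : |t₃ - t₄| = t₄ - t₃ := by rw [abs_of_nonpos] <;> linarith
      -- Alternating signs: TV = q(T - q) exactly.
      refine exp_neg_le_pairingKernel_of_sorted hT hk h12 h23 h34 ?_ h1 h4T
      rw [bridgeVariance, hTV, e12, e13, e24, e14, e32, e34]
      nlinarith
    · have e34 : |t₃ - t₄| = t₃ - t₄ := by rw [abs_of_nonneg]; linarith
      -- Signs + - - +: TV - q(T - q) = 4(t₂ - t₁)(t₃ - t₄) ≥ 0.
      have := exp_neg_le_pairingKernel_of_sorted (V := bridgeVariance T t₁ t₂ t₃ t₄) hT hk h12 h24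
        h43 (by
          rw [bridgeVariance, hTV, e12, e13, e24, e14, e32, e34]
          nlinarith [mul_nonneg (sub_nonneg.2 h12) (sub_nonneg.2 h43)]) h1 h3T
      refine this.trans_eq ?_
      unfold pairingKernel
      rw [circleKernel_comm T k t₄ t₃, circleKernel_comm T k t₄ t₂, circleKernel_comm T k t₂ t₃]
      ring

theorem setIntegral_exp_neg_abs_sub_le {k : ℝ} (hk : 0 < k) (s : Set ℝ) (c : ℝ) :
    ∫ t in s, Real.exp (-(k * |t - c|)) ≤ 2 / k := by
  have h : ∫ t : ℝ, Real.exp (-(k * |t - c|)) = 2 / k := by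
    rw [integral_sub_right_eq_self (fun t : ℝ ↦ Real.exp (-(k * |t|))) c,
      integral_comp_abs (f := fun t ↦ Real.exp (-(k * t)))]
    have := integral_exp_mul_Ioi (neg_lt_zero.2 hk) 0
    simp only [neg_mul, mul_zero, Real.exp_zero] at this
    rw [this]
    field_simp
  rw [← h]
  -- A non-integrable function has integral 0, so the nonzero value already computed gives
  -- integrability.
  refine setIntegral_le_integral (Integrable.of_integral_ne_zero ?_)
    (.of_forall fun t ↦ (Real.exp_pos _).le)
  rw [h]
  positivity

/-- The way round through 0 ≡ T has length at least s if s ≤ t and at least T - s if t ≤ s, so three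
exponentials on the line, centred at t, 0 and T, dominate the kernel. -/
theorem setIntegral_circleKernel_le {T k : ℝ} (hk : 0 < k) {t : ℝ}
    (ht : t ∈ Set.Icc 0 T) :
    ∫ s in Set.Icc 0 T, circleKernel T k s t ≤ 6 / k := by
  have hint (c : ℝ) : IntegrableOn (fun s ↦ Real.exp (-(k * |s - c|))) (Set.Icc 0 T) :=
    Continuous.integrableOn_Icc (by fun_prop)
  calc ∫ s in Set.Icc 0 T, circleKernel T k s t
      ≤ ∫ s in Set.Icc 0 T, (Real.exp (-(k * |s - t|)) + Real.exp (-(k * |s - 0|)) +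
          Real.exp (-(k * |s - T|))) := by
        refine setIntegral_mono_on (Continuous.integrableOn_Icc (by fun_prop))
          (((hint t).add (hint 0)).add (hint T)) measurableSet_Icc fun s hs ↦ ?_
        have p1 := Real.exp_pos (-(k * |s - t|))
        have p2 := Real.exp_pos (-(k * |s - 0|))
        have p3 := Real.exp_pos (-(k * |s - T|))
        unfold circleKernel circleDist
        rcases min_choice |s - t| (T - |s - t|) with h | h
        · rw [h]; linarith
        · rw [h]
          rcases le_total s t with hst | hst
          · have : Real.exp (-(k * (T - |s - t|))) ≤ Real.exp (-(k * |s - 0|)) := by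
              rw [Real.exp_le_exp, abs_of_nonpos (by linarith), abs_of_nonneg (by linarith [hs.1])]
              nlinarith [ht.2]
            linarith
          · have : Real.exp (-(k * (T - |s - t|))) ≤ Real.exp (-(k * |s - T|)) := by
              rw [Real.exp_le_exp, abs_of_nonneg (by linarith), abs_of_nonpos (by linarith [hs.2])]
              nlinarith [ht.1]
            linarith
    _ ≤ 2 / k + 2 / k + 2 / k := by
        rw [integral_add (by exact (hint t).add (hint 0)) (hint T), integral_add (hint t) (hint 0)]
        have := setIntegral_exp_neg_abs_sub_le hk (Set.Icc 0 T)
        gcongr <;> exact this _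
    _ = 6 / k := by ring

end CircleDist

/-! ### Joint measurability of continuous processes -/

section Modification

variable {Ω : Type*} [MeasurableSpace Ω] {μ : Measure Ω} {T : ℝ} {B : ℝ → Ω → ℝ}

theorem tendsto_floor_mul_div (t : ℝ) (ht : 0 ≤ t) :
    Tendsto (fun n : ℕ ↦ (⌊t * n⌋₊ : ℝ) / n) atTop (𝓝 t) :=
  (tendsto_nat_floor_mul_div_atTop ht).comp tendsto_natCast_atTop_atTop

/-- A process with almost surely continuous paths on `[0, T]` agrees on `[0, T]`, outside a null
set, with a jointly measurable process. -/
theorem exists_measurable_modification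
    (hmeas : ∀ t ∈ Set.Icc 0 T, AEMeasurable (B t) μ)
    (hcont : ∀ᵐ ω ∂μ, ContinuousOn (fun t ↦ B t ω) (Set.Icc 0 T)) :
    ∃ Z : Ω × ℝ → ℝ, Measurable Z ∧ ∀ᵐ ω ∂μ, ∀ t ∈ Set.Icc 0 T, Z (ω, t) = B t ω := by
  classical
  have hmod (t : ℝ) : ∃ Y : Ω → ℝ, Measurable Y ∧ (t ∈ Set.Icc 0 T → B t =ᵐ[μ] Y) := by
    by_cases ht : t ∈ Set.Icc 0 T
    · exact ⟨(hmeas t ht).mk, (hmeas t ht).measurable_mk, fun _ ↦ (hmeas t ht).ae_eq_mk⟩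
    · exact ⟨0, measurable_const, fun h ↦ (ht h).elim⟩
  choose Y hYm hY using hmod
  -- Only countably many times are involved, so the exceptional sets stay null; `n = 0` just gives
  -- time 0.
  have hgood : ∀ᵐ ω ∂μ, ContinuousOn (fun t ↦ B t ω) (Set.Icc 0 T) ∧
      ∀ n k : ℕ, (k / n : ℝ) ∈ Set.Icc 0 T → B (k / n) ω = Y (k / n) ω := by
    refine hcont.and (ae_all_iff.2 fun n ↦ ae_all_iff.2 fun k ↦ ?_)
    by_cases h : (k / n : ℝ) ∈ Set.Icc 0 T
    · filter_upwards [hY _ h] with ω hω _ using hω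
    · exact .of_forall fun ω h' ↦ (h h').elim
  obtain ⟨G, hG, hGm, hGsub⟩ := hgood.exists_measurable_mem
  have hS : MeasurableSet (G ×ˢ Set.Icc (0 : ℝ) T) := hGm.prod measurableSet_Icc
  refine ⟨(G ×ˢ Set.Icc 0 T).indicator fun p ↦ B p.2 p.1, ?_, ?_⟩
  -- Sampling at ⌊tn⌋/n gives jointly measurable approximations, which converge by path continuity
  -- on the good set.
  · refine measurable_of_tendsto_metrizable (f := fun (n : ℕ) ↦
      (G ×ˢ Set.Icc 0 T).indicator fun p ↦ Y ((⌊p.2 * n⌋₊ : ℝ) / n) p.1) (fun n ↦ ?_) ?_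
    · refine Measurable.indicator ?_ hS
      have h1 : Measurable fun q : ℕ × Ω ↦ Y ((q.1 : ℝ) / n) q.2 :=
        measurable_from_prod_countable_right fun k ↦ hYm ((k : ℝ) / n)
      have h2 : Measurable fun p : Ω × ℝ ↦ ((⌊p.2 * n⌋₊, p.1) : ℕ × Ω) := by fun_prop
      exact h1.comp h2
    · rw [tendsto_pi_nhds]
      rintro ⟨ω, t⟩
      by_cases h : (ω, t) ∈ G ×ˢ Set.Icc (0 : ℝ) T
      · simp only [Set.indicator_of_mem h]
        obtain ⟨hω, ht⟩ := h
        have hmem (n : ℕ) : ((⌊t * n⌋₊ : ℝ) / n) ∈ Set.Icc 0 T := by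
          refine ⟨by positivity, le_trans ?_ ht.2⟩
          rcases Nat.eq_zero_or_pos n with rfl | hn
          · simpa using ht.1
          · rw [div_le_iff₀ (by positivity)]
            exact Nat.floor_le (mul_nonneg ht.1 (by positivity))
        have hc := (hGsub ω hω).1 t ht
        have := hc.tendsto.comp (tendsto_nhdsWithin_iff.2
          ⟨tendsto_floor_mul_div t ht.1, .of_forall hmem⟩)
        refine this.congr fun n ↦ ?_
        exact (hGsub ω hω).2 n _ (hmem n)
      · simp only [Set.indicator_of_notMem h]
        exact tendsto_const_nhds
  · filter_upwards [hG] with ω hω t ht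
    exact Set.indicator_of_mem (s := G ×ˢ Set.Icc (0 : ℝ) T) ⟨hω, ht⟩ _

end Modification

/-! ### Fourier representation of the local time -/

section PathEnergy

theorem heatKernel_eq_integral {ε : ℝ} (hε : 0 < ε) (x : ℝ) :
    heatKernel ε x =
      (2 * Real.pi)⁻¹ * ∫ y : ℝ, Real.exp (-(ε / 2) * y ^ 2) * Real.cos (y * x) := by
  have hb : 0 < ((ε / 2 : ℝ) : ℂ).re := by simpa using hε
  have h := fourierIntegral_gaussian hb x
  have hre : ∫ y : ℝ, Real.exp (-(ε / 2) * y ^ 2) * Real.cos (y * x) =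
      (∫ y : ℝ, Complex.exp (Complex.I * x * y) * Complex.exp (-((ε / 2 : ℝ) : ℂ) * y ^ 2)).re := by
    have hint : Integrable fun y : ℝ ↦
        Complex.exp (Complex.I * x * y) * Complex.exp (-((ε / 2 : ℝ) : ℂ) * y ^ 2) := by
      refine Integrable.of_integral_ne_zero ?_
      rw [h]
      refine mul_ne_zero ?_ (Complex.exp_ne_zero _)
      rw [Complex.cpow_ne_zero_iff]
      left
      have := hε.ne'
      simp [Real.pi_ne_zero, this]
    rw [← RCLike.re_eq_complex_re, ← integral_re hint]
    refine integral_congr_ae (.of_forall fun y ↦ ?_)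
    simp only [RCLike.re_eq_complex_re]
    have h1 : Complex.I * x * y = ((y * x : ℝ) : ℂ) * Complex.I := by push_cast; ring
    have h2 : -((ε / 2 : ℝ) : ℂ) * y ^ 2 = ((-(ε / 2) * y ^ 2 : ℝ) : ℂ) := by push_cast; ring
    rw [h1, h2, ← Complex.ofReal_exp, Complex.re_mul_ofReal, Complex.exp_ofReal_mul_I_re, mul_comm]
  have hval : ((Real.pi : ℂ) / ((ε / 2 : ℝ) : ℂ)) ^ (1 / 2 : ℂ) *
      Complex.exp (-(x : ℂ) ^ 2 / (4 * ((ε / 2 : ℝ) : ℂ))) =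
      ((√(Real.pi / (ε / 2)) * Real.exp (-x ^ 2 / (2 * ε)) : ℝ) : ℂ) := by
    rw [Real.sqrt_eq_rpow, Complex.ofReal_mul, Complex.ofReal_cpow (by positivity)]
    push_cast
    congr 2
    ring
  rw [hre, h, hval, Complex.ofReal_re, heatKernel, ← mul_assoc]
  congr 1
  rw [eq_comm, ← sq_eq_sq₀ (by positivity) (by positivity), mul_pow, div_pow,
    Real.sq_sqrt (by positivity), Real.sq_sqrt (by positivity)]
  field_simp

theorem heatKernel_neg (ε x : ℝ) : heatKernel ε (-x) = heatKernel ε x := by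
  simp [heatKernel]

theorem continuous_heatKernel (ε : ℝ) : Continuous (heatKernel ε) := by
  unfold heatKernel
  fun_prop

/-- The diagonal splits the square into two triangles exchanged by symmetry; the diagonal itself is
null. -/
theorem integral_triangle_eq_half {T : ℝ} (hT : 0 ≤ T) {h : ℝ → ℝ → ℝ}
    (hsymm : ∀ s t, h s t = h t s)
    (hint : Integrable (Function.uncurry h)
      ((volume.restrict (Set.Icc 0 T)).prod (volume.restrict (Set.Icc 0 T)))) :
    ∫ t in (0 : ℝ)..T, ∫ s in (0 : ℝ)..t, h t s =
      2⁻¹ * ∫ p, h p.1 p.2 ∂(volume.restrict (Set.Icc 0 T)).prod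
        (volume.restrict (Set.Icc 0 T)) := by
  have hν : volume.restrict (Set.Icc 0 T) = volume.restrict (Set.Ioc 0 T) :=
    Measure.restrict_congr_set Ioc_ae_eq_Icc.symm
  rw [hν] at hint ⊢
  set ν := volume.restrict (Set.Ioc 0 T) with hνdef
  set A : Set (ℝ × ℝ) := {p | p.2 ≤ p.1} with hA
  have hAm : MeasurableSet A := measurableSet_le measurable_snd measurable_fst
  have hinner (t : ℝ) (ht : t ∈ Set.Ioc 0 T) :
      ∫ s in Set.Iic t, h t s ∂ν = ∫ s in (0 : ℝ)..t, h t s := by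
    rw [intervalIntegral.integral_of_le ht.1.le, hνdef, Measure.restrict_restrict measurableSet_Iic]
    congr 2
    ext s
    simp only [Set.mem_inter_iff, Set.mem_Iic, Set.mem_Ioc]
    constructor
    · rintro ⟨a, b, _⟩; exact ⟨b, a⟩
    · rintro ⟨a, b⟩; exact ⟨b, a, b.trans ht.2⟩
  have h1 : ∫ p in A, Function.uncurry h p ∂ν.prod ν =
      ∫ t in (0 : ℝ)..T, ∫ s in (0 : ℝ)..t, h t s := by
    rw [← integral_indicator hAm, integral_prod _ (hint.indicator hAm),
      intervalIntegral.integral_of_le hT]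
    refine setIntegral_congr_fun measurableSet_Ioc fun t ht ↦ ?_
    rw [← hinner t ht, ← integral_indicator measurableSet_Iic]
    rfl
  have h2 : ∫ p in Aᶜ, Function.uncurry h p ∂ν.prod ν =
      ∫ t in (0 : ℝ)..T, ∫ s in (0 : ℝ)..t, h t s := by
    rw [← integral_indicator hAm.compl, integral_prod_symm _ (hint.indicator hAm.compl),
      intervalIntegral.integral_of_le hT]
    refine setIntegral_congr_fun measurableSet_Ioc fun t ht ↦ ?_
    rw [← hinner t ht, Measure.restrict_congr_set (Iio_ae_eq_Iic (μ := ν) (a := t)).symm,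
      ← integral_indicator measurableSet_Iio]
    refine integral_congr_ae (.of_forall fun s ↦ ?_)
    by_cases hst : s < t
    · simp [Set.indicator, hA, hst, hsymm s t]
    · simp [Set.indicator, hA, hst]
  have h3 := integral_add_compl hAm hint
  rw [h1, h2] at h3
  have h4 : ∫ p, Function.uncurry h p ∂ν.prod ν = ∫ p, h p.1 p.2 ∂ν.prod ν := rfl
  rw [← h4, ← h3]
  ring

/-- The squared modulus `|∫ exp (i y f) dν|²`, written as a double integral. -/
noncomputable def pathEnergy (ν : Measure ℝ) (f : ℝ → ℝ) (y : ℝ) : ℝ :=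
  ∫ p, Real.cos (y * (f p.1 - f p.2)) ∂ν.prod ν

variable {ν : Measure ℝ} [IsFiniteMeasure ν] {f : ℝ → ℝ}

theorem integrable_cexp_mul_I {α : Type*} [MeasurableSpace α] {m : Measure α} [IsFiniteMeasure m]
    {g : α → ℝ} (hg : Measurable g) :
    Integrable (fun a ↦ Complex.exp ((g a : ℝ) * Complex.I)) m :=
  Integrable.of_bound (by fun_prop) 1
    (.of_forall fun a ↦ (Complex.norm_exp_ofReal_mul_I _).le)

theorem integral_cexp_sub (f : ℝ → ℝ) (y : ℝ) :
    ∫ p, Complex.exp ((y * (f p.1 - f p.2) : ℝ) * Complex.I) ∂ν.prod ν =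
      (‖∫ t, Complex.exp ((y * f t : ℝ) * Complex.I) ∂ν‖ ^ 2 : ℝ) := by
  have h (p : ℝ × ℝ) : Complex.exp ((y * (f p.1 - f p.2) : ℝ) * Complex.I) =
      Complex.exp ((y * f p.1 : ℝ) * Complex.I) *
        (starRingEnd ℂ) (Complex.exp ((y * f p.2 : ℝ) * Complex.I)) := by
    rw [← Complex.exp_conj, ← Complex.exp_add, map_mul, Complex.conj_ofReal, Complex.conj_I]
    congr 1
    push_cast
    ring
  simp_rw [h]
  rw [integral_prod_mul (fun t ↦ Complex.exp ((y * f t : ℝ) * Complex.I))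
    (fun t ↦ (starRingEnd ℂ) (Complex.exp ((y * f t : ℝ) * Complex.I))), integral_conj,
    Complex.mul_conj, Complex.normSq_eq_norm_sq]

theorem pathEnergy_eq_norm_sq (hf : Measurable f) (y : ℝ) :
    pathEnergy ν f y = ‖∫ t, Complex.exp ((y * f t : ℝ) * Complex.I) ∂ν‖ ^ 2 := by
  have h := congrArg Complex.re (integral_cexp_sub (ν := ν) f y)
  rw [Complex.ofReal_re, ← RCLike.re_eq_complex_re,
    ← integral_re (integrable_cexp_mul_I (by fun_prop))] at h
  rw [← h, pathEnergy]
  simp only [RCLike.re_eq_complex_re, Complex.exp_ofReal_mul_I_re]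

theorem pathEnergy_nonneg (hf : Measurable f) (y : ℝ) : 0 ≤ pathEnergy ν f y := by
  rw [pathEnergy_eq_norm_sq hf]
  positivity

theorem pathEnergy_le (hf : Measurable f) (y : ℝ) : pathEnergy ν f y ≤ ν.real Set.univ ^ 2 := by
  rw [pathEnergy_eq_norm_sq hf]
  have := norm_integral_le_of_norm_le_const (μ := ν) (C := 1)
    (f := fun t ↦ Complex.exp ((y * f t : ℝ) * Complex.I))
    (.of_forall fun a ↦ (Complex.norm_exp_ofReal_mul_I _).le)
  rw [one_mul] at this
  gcongr

/-- This turns the second moment of the energy into an integral of characteristic functions over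
four times. -/
theorem ofReal_pathEnergy_sq (hf : Measurable f) (y : ℝ) :
    ((pathEnergy ν f y ^ 2 : ℝ) : ℂ) =
      ∫ p, Complex.exp ((y * (f p.1.1 - f p.1.2 + f p.2.1 - f p.2.2) : ℝ) * Complex.I)
        ∂(ν.prod ν).prod (ν.prod ν) := by
  have h := integral_cexp_sub (ν := ν) f y
  rw [← pathEnergy_eq_norm_sq hf] at h
  rw [Complex.ofReal_pow, ← h, sq, ← integral_prod_mul]
  refine integral_congr_ae (.of_forall fun p ↦ ?_)
  simp only
  rw [← Complex.exp_add]
  congr 1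
  push_cast
  ring

theorem integral_heatKernel_eq {ε : ℝ} (hε : 0 < ε) (hf : Measurable f) :
    ∫ p, heatKernel ε (f p.1 - f p.2) ∂ν.prod ν =
      (2 * Real.pi)⁻¹ * ∫ y : ℝ, Real.exp (-(ε / 2) * y ^ 2) * pathEnergy ν f y := by
  simp_rw [heatKernel_eq_integral hε, pathEnergy, ← integral_const_mul]
  refine integral_integral_swap ?_
  have hdom : Integrable (fun z : (ℝ × ℝ) × ℝ ↦
      (2 * Real.pi)⁻¹ * Real.exp (-(ε / 2) * z.2 ^ 2)) ((ν.prod ν).prod volume) :=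
    (integrable_const (2 * Real.pi)⁻¹).mul_prod
      (integrable_exp_neg_mul_sq (by positivity : 0 < ε / 2))
  refine hdom.mono (Measurable.aestronglyMeasurable (by fun_prop)) (.of_forall fun z ↦ ?_)
  simp only [Function.uncurry, norm_mul]
  have := Real.abs_cos_le_one (z.2 * (f z.1.1 - f z.1.2))
  refine mul_le_mul_of_nonneg_left (mul_le_of_le_one_right (norm_nonneg _) this) (norm_nonneg _)

end PathEnergy

/-! ### Second moment of the path energy -/

section Moment

theorem circleKernel_le_one {T k s t : ℝ} (hk : 0 ≤ k) (hs : s ∈ Set.Icc 0 T)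
    (ht : t ∈ Set.Icc 0 T) : circleKernel T k s t ≤ 1 := by
  rw [circleKernel, Real.exp_le_one_iff, neg_nonpos]
  refine mul_nonneg hk (le_min (abs_nonneg _) ?_)
  have : |s - t| ≤ T := abs_sub_le_iff.2 ⟨by linarith [hs.2, ht.1], by linarith [hs.1, ht.2]⟩
  linarith

/-- In each pairing the two kernels share no variable, so by Fubini each of the three terms is the
square of the double integral of one kernel. -/
theorem integral_pairingKernel {T k : ℝ} (hk : 0 ≤ k) :
    let ν := volume.restrict (Set.Icc 0 T)
    Integrable (fun p : (ℝ × ℝ) × ℝ × ℝ ↦ pairingKernel T k p.1.1 p.1.2 p.2.1 p.2.2)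
        ((ν.prod ν).prod (ν.prod ν)) ∧
      ∫ p, pairingKernel T k p.1.1 p.1.2 p.2.1 p.2.2 ∂(ν.prod ν).prod (ν.prod ν) =
        3 * (∫ t, ∫ s, circleKernel T k s t ∂ν ∂ν) ^ 2 := by
  intro ν
  have hmem : ∀ᵐ t ∂ν, t ∈ Set.Icc 0 T := ae_restrict_mem measurableSet_Icc
  have hmem2 : ∀ᵐ p ∂ν.prod ν, p.1 ∈ Set.Icc 0 T ∧ p.2 ∈ Set.Icc 0 T :=
    (Measure.quasiMeasurePreserving_fst.ae hmem).and (Measure.quasiMeasurePreserving_snd.ae hmem)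
  have hmem4 : ∀ᵐ p ∂(ν.prod ν).prod (ν.prod ν),
      (p.1.1 ∈ Set.Icc 0 T ∧ p.1.2 ∈ Set.Icc 0 T) ∧ p.2.1 ∈ Set.Icc 0 T ∧ p.2.2 ∈ Set.Icc 0 T :=
    (Measure.quasiMeasurePreserving_fst.ae hmem2).and
      (Measure.quasiMeasurePreserving_snd.ae hmem2)
  have hc : Continuous fun p : ℝ × ℝ ↦ circleKernel T k p.1 p.2 := continuous_circleKernel T k
  have hcm {g h : (ℝ × ℝ) × ℝ × ℝ → ℝ} (hg : Continuous g) (hh : Continuous h) :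
      Continuous fun p ↦ circleKernel T k (g p) (h p) := hc.comp (hg.prodMk hh)
  have key {a b c d : (ℝ × ℝ) × ℝ × ℝ → ℝ} (ha : Continuous a) (hb : Continuous b)
      (hc : Continuous c) (hd : Continuous d)
      (hab : ∀ᵐ p ∂(ν.prod ν).prod (ν.prod ν), (a p ∈ Set.Icc 0 T ∧ b p ∈ Set.Icc 0 T) ∧
        c p ∈ Set.Icc 0 T ∧ d p ∈ Set.Icc 0 T) :
      Integrable (fun p ↦ circleKernel T k (a p) (b p) * circleKernel T k (c p) (d p))
        ((ν.prod ν).prod (ν.prod ν)) := by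
    refine Integrable.of_bound
      ((hcm ha hb).mul (hcm hc hd)).measurable.aestronglyMeasurable 1 ?_
    filter_upwards [hab] with p hp
    rw [Real.norm_of_nonneg (mul_nonneg (circleKernel_nonneg ..) (circleKernel_nonneg ..))]
    exact mul_le_one₀ (circleKernel_le_one hk hp.1.1 hp.1.2) (circleKernel_nonneg ..)
      (circleKernel_le_one hk hp.2.1 hp.2.2)
  have i1 := key (a := fun p ↦ p.1.1) (b := fun p ↦ p.1.2) (c := fun p ↦ p.2.1)
    (d := fun p ↦ p.2.2) (by fun_prop) (by fun_prop) (by fun_prop) (by fun_prop) hmem4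
  have i2 := key (a := fun p ↦ p.1.1) (b := fun p ↦ p.2.2) (c := fun p ↦ p.2.1)
    (d := fun p ↦ p.1.2) (by fun_prop) (by fun_prop) (by fun_prop) (by fun_prop)
    (hmem4.mono fun p h ↦ by tauto)
  have i3 := key (a := fun p ↦ p.1.1) (b := fun p ↦ p.2.1) (c := fun p ↦ p.1.2)
    (d := fun p ↦ p.2.2) (by fun_prop) (by fun_prop) (by fun_prop) (by fun_prop)
    (hmem4.mono fun p h ↦ by tauto)
  refine ⟨(i1.add i2).add i3, ?_⟩
  set u : ℝ → ℝ := fun t ↦ ∫ s, circleKernel T k s t ∂ν with hu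
  have hu' (t : ℝ) : ∫ s, circleKernel T k t s ∂ν = u t := by simp_rw [circleKernel_comm T k t, hu]
  have hKK : ∫ p, circleKernel T k p.1 p.2 ∂ν.prod ν = ∫ t, u t ∂ν := by
    rw [integral_prod]
    · simp_rw [hu']
    · refine Integrable.of_bound hc.measurable.aestronglyMeasurable 1 ?_
      filter_upwards [hmem2] with p hp
      rw [Real.norm_of_nonneg (circleKernel_nonneg ..)]
      exact circleKernel_le_one hk hp.1 hp.2
  have e1 := integral_prod_mul (μ := ν.prod ν) (ν := ν.prod ν)
    (fun p : ℝ × ℝ ↦ circleKernel T k p.1 p.2) (fun p ↦ circleKernel T k p.1 p.2)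
  have e2 : ∫ p, circleKernel T k p.1.1 p.2.2 * circleKernel T k p.2.1 p.1.2
      ∂(ν.prod ν).prod (ν.prod ν) = (∫ t, u t ∂ν) * ∫ t, u t ∂ν := by
    rw [integral_prod _ i2, ← integral_prod_mul]
    refine integral_congr_ae (.of_forall fun p ↦ ?_)
    simp only
    rw [mul_comm (u _), ← hu' p.1, hu, ← integral_prod_mul]
    exact integral_congr_ae (.of_forall fun q ↦ mul_comm _ _)
  have e3 : ∫ p, circleKernel T k p.1.1 p.2.1 * circleKernel T k p.1.2 p.2.2
      ∂(ν.prod ν).prod (ν.prod ν) = (∫ t, u t ∂ν) * ∫ t, u t ∂ν := by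
    rw [integral_prod _ i3, ← integral_prod_mul]
    refine integral_congr_ae (.of_forall fun p ↦ ?_)
    simp only
    rw [← hu' p.1, ← hu' p.2, ← integral_prod_mul]
  rw [hKK] at e1
  unfold pairingKernel
  rw [integral_add (by exact i1.add i2) i3, integral_add i1 i2, e1, e2, e3]
  ring

theorem integral_pairingKernel_le {T k : ℝ} (hT : 0 ≤ T) (hk : 0 < k) :
    let ν := volume.restrict (Set.Icc 0 T)
    ∫ p, pairingKernel T k p.1.1 p.1.2 p.2.1 p.2.2 ∂(ν.prod ν).prod (ν.prod ν) ≤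
      3 * (T * (6 / k)) ^ 2 := by
  intro ν
  rw [(integral_pairingKernel hk.le).2]
  have h0 : 0 ≤ ∫ t, ∫ s, circleKernel T k s t ∂ν ∂ν :=
    integral_nonneg fun t ↦ integral_nonneg fun s ↦ circleKernel_nonneg ..
  have h1 : ∫ t, ∫ s, circleKernel T k s t ∂ν ∂ν ≤ T * (6 / k) := by
    have hle := integral_mono_of_nonneg (μ := ν) (f := fun t ↦ ∫ s, circleKernel T k s t ∂ν)
      (g := fun _ ↦ 6 / k)
      (.of_forall fun t ↦ integral_nonneg fun s ↦ circleKernel_nonneg ..) (integrable_const _)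
      ((ae_restrict_mem measurableSet_Icc).mono fun t ht ↦ setIntegral_circleKernel_le hk ht)
    refine hle.trans_eq ?_
    simp [ν, hT]
  gcongr

variable {Ω : Type*} [MeasurableSpace Ω] {μ : Measure Ω} [IsProbabilityMeasure μ]
  {Z : Ω × ℝ → ℝ} {T : ℝ}

theorem measurable_pathEnergy {ν : Measure ℝ} [IsFiniteMeasure ν] (hZ : Measurable Z) :
    Measurable fun q : Ω × ℝ ↦ pathEnergy ν (fun t ↦ Z (q.1, t)) q.2 := by
  unfold pathEnergy
  refine StronglyMeasurable.measurable ?_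
  refine StronglyMeasurable.integral_prod_right
    (f := fun (q : Ω × ℝ) (p : ℝ × ℝ) ↦ Real.cos (q.2 * (Z (q.1, p.1) - Z (q.1, p.2)))) ?_
  refine Measurable.stronglyMeasurable ?_
  simp only [Function.uncurry_def]
  fun_prop

/-- The bound on the characteristic functions of the second-order increments of a process from
which the fourth moments of its Fourier transform are estimated. -/
def HasPairingBound (μ : Measure Ω) (T : ℝ) (Z : Ω × ℝ → ℝ) : Prop :=
  ∀ y : ℝ, ∀ t₁ ∈ Set.Icc 0 T, ∀ t₂ ∈ Set.Icc 0 T, ∀ t₃ ∈ Set.Icc 0 T, ∀ t₄ ∈ Set.Icc 0 T,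
    ‖∫ ω, Complex.exp ((y * (Z (ω, t₁) - Z (ω, t₂) + Z (ω, t₃) - Z (ω, t₄)) : ℝ) * Complex.I) ∂μ‖ ≤
      pairingKernel T (y ^ 2 / 4) t₁ t₂ t₃ t₄

/-- Fubini moves the expectation inside the fourfold time integral, where the pairing bound applies
with k = y²/4; the constant is 3 · (6 · 4)² = 1728. -/
theorem integral_pathEnergy_sq_le (hT : 0 ≤ T) (hZ : Measurable Z) (h : HasPairingBound μ T Z)
    {y : ℝ} (hy : y ≠ 0) :
    ∫ ω, pathEnergy (volume.restrict (Set.Icc 0 T)) (fun t ↦ Z (ω, t)) y ^ 2 ∂μ ≤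
      1728 * T ^ 2 / y ^ 4 := by
  set ν := volume.restrict (Set.Icc 0 T) with hν
  have hk : 0 < y ^ 2 / 4 := by positivity
  have hmem : ∀ᵐ t ∂ν, t ∈ Set.Icc 0 T := ae_restrict_mem measurableSet_Icc
  have hmem2 : ∀ᵐ p ∂ν.prod ν, p.1 ∈ Set.Icc 0 T ∧ p.2 ∈ Set.Icc 0 T :=
    (Measure.quasiMeasurePreserving_fst.ae hmem).and (Measure.quasiMeasurePreserving_snd.ae hmem)
  have hmem4 : ∀ᵐ p ∂(ν.prod ν).prod (ν.prod ν),
      (p.1.1 ∈ Set.Icc 0 T ∧ p.1.2 ∈ Set.Icc 0 T) ∧ p.2.1 ∈ Set.Icc 0 T ∧ p.2.2 ∈ Set.Icc 0 T :=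
    (Measure.quasiMeasurePreserving_fst.ae hmem2).and
      (Measure.quasiMeasurePreserving_snd.ae hmem2)
  have hcalc : ((∫ ω, pathEnergy ν (fun t ↦ Z (ω, t)) y ^ 2 ∂μ : ℝ) : ℂ) =
      ∫ p, ∫ ω, Complex.exp ((y * (Z (ω, p.1.1) - Z (ω, p.1.2) + Z (ω, p.2.1) - Z (ω, p.2.2)) : ℝ)
        * Complex.I) ∂μ ∂(ν.prod ν).prod (ν.prod ν) := by
    rw [← integral_complex_ofReal]
    simp_rw [fun ω ↦ ofReal_pathEnergy_sq (ν := ν) (f := fun t ↦ Z (ω, t)) (by fun_prop) y]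
    refine integral_integral_swap ?_
    exact integrable_cexp_mul_I (m := μ.prod ((ν.prod ν).prod (ν.prod ν)))
      (g := fun q ↦ y * (Z (q.1, q.2.1.1) - Z (q.1, q.2.1.2) + Z (q.1, q.2.2.1)
        - Z (q.1, q.2.2.2))) (by fun_prop)
  calc ∫ ω, pathEnergy ν (fun t ↦ Z (ω, t)) y ^ 2 ∂μ
      ≤ ‖((∫ ω, pathEnergy ν (fun t ↦ Z (ω, t)) y ^ 2 ∂μ : ℝ) : ℂ)‖ := by
        rw [Complex.norm_real]; exact le_abs_self _
    _ ≤ ∫ p, pairingKernel T (y ^ 2 / 4) p.1.1 p.1.2 p.2.1 p.2.2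
          ∂(ν.prod ν).prod (ν.prod ν) := by
        rw [hcalc]
        exact norm_integral_le_of_norm_le (integral_pairingKernel hk.le).1
          (hmem4.mono fun p hp ↦ h y _ hp.1.1 _ hp.1.2 _ hp.2.1 _ hp.2.2)
    _ ≤ 3 * (T * (6 / (y ^ 2 / 4))) ^ 2 := integral_pairingKernel_le hT hk
    _ = 1728 * T ^ 2 / y ^ 4 := by field_simp; ring

/-- For y² ≤ 1 the trivial bound T⁴ is used with (1 + y²)² ≤ 4; for y² ≥ 1 the y⁻⁴ decay is used
with (1 + y²)² ≤ 4y⁴, and 6912 = 4 · 1728. -/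
theorem weighted_integral_pathEnergy_sq_le (hT : 0 ≤ T) (hZ : Measurable Z)
    (h : HasPairingBound μ T Z) (y : ℝ) :
    (1 + y ^ 2) * ∫ ω, pathEnergy (volume.restrict (Set.Icc 0 T)) (fun t ↦ Z (ω, t)) y ^ 2 ∂μ ≤
      (4 * T ^ 4 + 6912 * T ^ 2) * (1 + y ^ 2)⁻¹ := by
  rw [← div_eq_mul_inv, le_div_iff₀ (by positivity)]
  set E := ∫ ω, pathEnergy (volume.restrict (Set.Icc 0 T)) (fun t ↦ Z (ω, t)) y ^ 2 ∂μ
  have hE0 : 0 ≤ E := integral_nonneg fun ω ↦ sq_nonneg _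
  rcases le_total (y ^ 2) 1 with hy | hy
  · have hE : E ≤ T ^ 4 := by
      have hle := integral_mono_of_nonneg (μ := μ)
        (f := fun ω ↦ pathEnergy (volume.restrict (Set.Icc 0 T)) (fun t ↦ Z (ω, t)) y ^ 2)
        (g := fun _ ↦ T ^ 4) (.of_forall fun ω ↦ sq_nonneg _) (integrable_const _)
        (.of_forall fun ω ↦ by
          have h1 := pathEnergy_le (ν := volume.restrict (Set.Icc 0 T))
            (f := fun t ↦ Z (ω, t)) (by fun_prop) y
          have h2 := pathEnergy_nonneg (ν := volume.restrict (Set.Icc 0 T))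
            (f := fun t ↦ Z (ω, t)) (by fun_prop) y
          have h3 : (volume.restrict (Set.Icc 0 T)).real Set.univ = T := by simp [hT]
          rw [h3] at h1
          exact (pow_le_pow_left₀ h2 h1 2).trans_eq (by ring))
      simpa using hle
    nlinarith [sq_nonneg T, mul_nonneg hE0 (sub_nonneg.2 hy), sq_nonneg y,
      mul_nonneg (mul_nonneg hE0 (sub_nonneg.2 hy)) (sq_nonneg y)]
  · have hy0 : y ≠ 0 := by rintro rfl; norm_num at hy
    have hE := integral_pathEnergy_sq_le hT hZ h hy0
    rw [le_div_iff₀ (by positivity)] at hE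
    change E * y ^ 4 ≤ _ at hE
    have : (1 + y ^ 2) ^ 2 ≤ 4 * y ^ 4 := by nlinarith
    nlinarith [mul_le_mul_of_nonneg_left this hE0, pow_nonneg hT 4]

end Moment

/-! ### Square integrability of the total energy and L² convergence -/

section Convergence

open scoped ENNReal

variable {Ω : Type*} [MeasurableSpace Ω] {μ : Measure Ω} [IsProbabilityMeasure μ]
  {Z : Ω × ℝ → ℝ} {T : ℝ}

/-- Cauchy–Schwarz for (1 + y²)^(-1/2) and (1 + y²)^(1/2) |f|, stated with lower integrals so that
integrability of `f` is not needed beforehand. -/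
theorem lintegral_sq_le_weighted {f : ℝ → ℝ} (hf : Measurable f) :
    (∫⁻ y, ENNReal.ofReal (f y)) ^ 2 ≤
      (∫⁻ y : ℝ, ENNReal.ofReal (1 + y ^ 2)⁻¹) * ∫⁻ y, ENNReal.ofReal ((1 + y ^ 2) * f y ^ 2) := by
  have h := ENNReal.lintegral_mul_le_Lp_mul_Lq volume Real.HolderConjugate.two_two
    (f := fun y : ℝ ↦ ENNReal.ofReal (√(1 + y ^ 2))⁻¹)
    (g := fun y ↦ ENNReal.ofReal (√(1 + y ^ 2) * |f y|)) (by fun_prop) (by fun_prop)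
  have h1 : ∫⁻ y, ENNReal.ofReal (f y) ≤ ∫⁻ y, ((fun y : ℝ ↦ ENNReal.ofReal (√(1 + y ^ 2))⁻¹) *
      fun y ↦ ENNReal.ofReal (√(1 + y ^ 2) * |f y|)) y := by
    refine lintegral_mono fun y ↦ ?_
    have hpos : 0 < √(1 + y ^ 2) := by positivity
    rw [Pi.mul_apply, ← ENNReal.ofReal_mul (by positivity), inv_mul_cancel_left₀ hpos.ne']
    exact ENNReal.ofReal_le_ofReal (le_abs_self _)
  have h2 (y : ℝ) : ENNReal.ofReal (√(1 + y ^ 2))⁻¹ ^ (2 : ℝ) = ENNReal.ofReal (1 + y ^ 2)⁻¹ := by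
    rw [ENNReal.rpow_two, ← ENNReal.ofReal_pow (by positivity), inv_pow, Real.sq_sqrt (by positivity)]
  have h3 (y : ℝ) : ENNReal.ofReal (√(1 + y ^ 2) * |f y|) ^ (2 : ℝ) =
      ENNReal.ofReal ((1 + y ^ 2) * f y ^ 2) := by
    rw [ENNReal.rpow_two, ← ENNReal.ofReal_pow (by positivity), mul_pow,
      Real.sq_sqrt (by positivity), sq_abs]
  simp_rw [h2, h3] at h
  refine (pow_le_pow_left₀ zero_le (h1.trans h) 2).trans_eq ?_
  rw [mul_pow, ← ENNReal.rpow_natCast, ← ENNReal.rpow_natCast, ← ENNReal.rpow_mul,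
    ← ENNReal.rpow_mul]
  norm_num

theorem lintegral_inv_one_add_sq_lt_top : ∫⁻ y : ℝ, ENNReal.ofReal (1 + y ^ 2)⁻¹ < ∞ := by
  have := (hasFiniteIntegral_iff_ofReal (.of_forall fun y : ℝ ↦ by positivity)).1
    integrable_inv_one_add_sq.hasFiniteIntegral
  exact this

/-- This supplies the square-integrable majorant, uniform in ε, for the passage to the limit. -/
theorem lintegral_sq_lintegral_pathEnergy_lt_top (hT : 0 ≤ T) (hZ : Measurable Z)
    (h : HasPairingBound μ T Z) :
    ∫⁻ ω, (∫⁻ y, ENNReal.ofReal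
      (pathEnergy (volume.restrict (Set.Icc 0 T)) (fun t ↦ Z (ω, t)) y)) ^ 2 ∂μ < ∞ := by
  set ν := volume.restrict (Set.Icc 0 T) with hν
  have hM : Measurable fun q : Ω × ℝ ↦ pathEnergy ν (fun t ↦ Z (q.1, t)) q.2 :=
    measurable_pathEnergy hZ
  have hM' (ω : Ω) : Measurable fun y ↦ pathEnergy ν (fun t ↦ Z (ω, t)) y :=
    Measurable.of_uncurry_left (f := fun ω y ↦ pathEnergy ν (fun t ↦ Z (ω, t)) y) hM
  calc ∫⁻ ω, (∫⁻ y, ENNReal.ofReal (pathEnergy ν (fun t ↦ Z (ω, t)) y)) ^ 2 ∂μ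
      ≤ ∫⁻ ω, ((∫⁻ y : ℝ, ENNReal.ofReal (1 + y ^ 2)⁻¹) *
          ∫⁻ y, ENNReal.ofReal ((1 + y ^ 2) * pathEnergy ν (fun t ↦ Z (ω, t)) y ^ 2)) ∂μ :=
        lintegral_mono fun ω ↦ lintegral_sq_le_weighted (hM' ω)
    _ = (∫⁻ y : ℝ, ENNReal.ofReal (1 + y ^ 2)⁻¹) * ∫⁻ y, ∫⁻ ω,
          ENNReal.ofReal ((1 + y ^ 2) * pathEnergy ν (fun t ↦ Z (ω, t)) y ^ 2) ∂μ := by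
        rw [lintegral_const_mul' _ _ lintegral_inv_one_add_sq_lt_top.ne, lintegral_lintegral_swap]
        exact (Measurable.ennreal_ofReal (f := fun q : Ω × ℝ ↦
          (1 + q.2 ^ 2) * pathEnergy ν (fun t ↦ Z (q.1, t)) q.2 ^ 2) (by fun_prop)).aemeasurable
    _ ≤ (∫⁻ y : ℝ, ENNReal.ofReal (1 + y ^ 2)⁻¹) * ∫⁻ y : ℝ,
          ENNReal.ofReal (4 * T ^ 4 + 6912 * T ^ 2) * ENNReal.ofReal (1 + y ^ 2)⁻¹ := by
        gcongr with y
        rw [← ENNReal.ofReal_mul (by positivity), ← ofReal_integral_eq_lintegral_ofReal,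
          integral_const_mul]
        · exact ENNReal.ofReal_le_ofReal (weighted_integral_pathEnergy_sq_le hT hZ h y)
        · refine Integrable.const_mul ?_ _
          refine Integrable.of_bound
            ((Measurable.of_uncurry_right (f := fun ω y ↦ pathEnergy ν (fun t ↦ Z (ω, t)) y)
              hM).pow_const 2).aestronglyMeasurable
            ((ν.real Set.univ ^ 2) ^ 2) (.of_forall fun ω ↦ ?_)
          rw [Real.norm_of_nonneg (sq_nonneg _)]
          exact pow_le_pow_left₀ (pathEnergy_nonneg (by fun_prop) y)
            (pathEnergy_le (by fun_prop) y) 2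
        · exact .of_forall fun ω ↦ by positivity
    _ < ∞ := by
        rw [lintegral_const_mul' _ _ ENNReal.ofReal_ne_top]
        have := lintegral_inv_one_add_sq_lt_top
        exact ENNReal.mul_lt_top this (ENNReal.mul_lt_top ENNReal.ofReal_lt_top this)

/-- Convergence in `L²` of the approximated self-intersection local times of a jointly measurable
process. -/
theorem exists_tendsto_eLpNorm_integral_heatKernel (hT : 0 ≤ T) (hZ : Measurable Z)
    (h : HasPairingBound μ T Z) :
    let ν := volume.restrict (Set.Icc 0 T)
    let J := fun (ε : ℝ) (ω : Ω) ↦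
      2⁻¹ * ∫ p, heatKernel ε (Z (ω, p.1) - Z (ω, p.2)) ∂ν.prod ν
    ∃ I : Ω → ℝ, MemLp I 2 μ ∧
      Tendsto (fun ε : ℝ ↦ eLpNorm (J ε - I) 2 μ) (𝓝[>] 0) (𝓝 0) := by
  intro ν J
  set M : Ω → ℝ → ℝ := fun ω y ↦ pathEnergy ν (fun t ↦ Z (ω, t)) y with hMdef
  have hM : Measurable fun q : Ω × ℝ ↦ M q.1 q.2 := measurable_pathEnergy hZ
  have hM' (ω : Ω) : Measurable (M ω) := Measurable.of_uncurry_left (f := M) hM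
  have hM0 (ω : Ω) (y : ℝ) : 0 ≤ M ω y := pathEnergy_nonneg (by fun_prop) y
  set G : Ω → ℝ≥0∞ := fun ω ↦ ∫⁻ y, ENNReal.ofReal (M ω y) with hG
  have hGm : Measurable G := Measurable.lintegral_prod_right (by fun_prop)
  have hG2 : ∫⁻ ω, G ω ^ 2 ∂μ < ∞ := lintegral_sq_lintegral_pathEnergy_lt_top hT hZ h
  have hMe (ω : Ω) (y : ℝ) : ‖M ω y‖ₑ = ENNReal.ofReal (M ω y) := Real.enorm_of_nonneg (hM0 ω y)
  have hfin : ∀ᵐ ω ∂μ, Integrable (M ω) := by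
    filter_upwards [ae_lt_top (hGm.pow_const 2) hG2.ne] with ω hω
    refine ⟨(hM' ω).aestronglyMeasurable, ?_⟩
    rw [hasFiniteIntegral_iff_enorm]
    simp_rw [hMe]
    exact (ENNReal.pow_lt_top_iff.1 hω).resolve_right (by norm_num)
  have hJ {ε : ℝ} (hε : 0 < ε) (ω : Ω) :
      J ε ω = (4 * Real.pi)⁻¹ * ∫ y, Real.exp (-(ε / 2) * y ^ 2) * M ω y := by
    simp only [J]
    rw [integral_heatKernel_eq (f := fun t ↦ Z (ω, t)) hε (by fun_prop), ← mul_assoc]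
    congr 1
    field_simp
    norm_num
  set c : ℝ := (4 * Real.pi)⁻¹ with hc
  have hbound : ∫⁻ ω, (‖c‖ₑ * G ω) ^ 2 ∂μ < ∞ := by
    simp_rw [mul_pow]
    rw [lintegral_const_mul _ (hGm.pow_const 2)]
    exact ENNReal.mul_lt_top (ENNReal.pow_lt_top enorm_lt_top) hG2
  -- The limit is the value of the Fourier formula at ε = 0.
  set I : Ω → ℝ := fun ω ↦ c * ∫ y, M ω y with hI
  have hIm : Measurable I :=
    (StronglyMeasurable.integral_prod_right (f := M) hM.stronglyMeasurable).measurable.const_mul c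
  have hJm (ε : ℝ) : Measurable (J ε) := by
    refine Measurable.const_mul (StronglyMeasurable.measurable ?_) _
    refine StronglyMeasurable.integral_prod_right
      (f := fun (ω : Ω) (p : ℝ × ℝ) ↦ heatKernel ε (Z (ω, p.1) - Z (ω, p.2))) ?_
    refine Measurable.stronglyMeasurable ((continuous_heatKernel ε).measurable.comp ?_)
    fun_prop
  have hIG (ω : Ω) : ‖I ω‖ₑ ≤ ‖c‖ₑ * G ω := by
    simp only [hI, enorm_mul]
    gcongr
    refine (enorm_integral_le_lintegral_enorm _).trans_eq ?_
    simp_rw [hMe, hG]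
  -- Since 0 < exp(-εy²/2) ≤ 1 and the energy is nonnegative, the difference is dominated by the
  -- full energy for every ε.
  have hJI {ε : ℝ} (hε : 0 < ε) : ∀ᵐ ω ∂μ, ‖(J ε - I) ω‖ₑ ^ 2 ≤ (‖c‖ₑ * G ω) ^ 2 := by
    filter_upwards [hfin] with ω hω
    have hexp (y : ℝ) : Real.exp (-(ε / 2) * y ^ 2) ≤ 1 := by
      rw [Real.exp_le_one_iff]
      nlinarith [sq_nonneg y, mul_nonneg hε.le (sq_nonneg y)]
    have hint : Integrable fun y ↦ Real.exp (-(ε / 2) * y ^ 2) * M ω y := by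
      refine hω.mono (Measurable.aestronglyMeasurable (by fun_prop)) (.of_forall fun y ↦ ?_)
      rw [norm_mul, Real.norm_of_nonneg (Real.exp_pos _).le]
      exact mul_le_of_le_one_left (norm_nonneg _) (hexp y)
    have hsub : (J ε - I) ω = c * ∫ y, (Real.exp (-(ε / 2) * y ^ 2) * M ω y - M ω y) := by
      rw [integral_sub hint hω, Pi.sub_apply, hJ hε]
      ring
    rw [hsub, enorm_mul]
    gcongr
    refine (enorm_integral_le_lintegral_enorm _).trans (lintegral_mono fun y ↦ ?_)
    rw [← hMe]
    refine enorm_le_iff_norm_le.2 ?_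
    rw [Real.norm_of_nonpos, Real.norm_of_nonneg (hM0 ω y)]
    · nlinarith [hM0 ω y, Real.exp_pos (-(ε / 2) * y ^ 2)]
    · nlinarith [hM0 ω y, hexp y]
  have hlim : ∀ᵐ ω ∂μ, Tendsto (fun ε ↦ ‖(J ε - I) ω‖ₑ ^ 2) (𝓝[>] 0) (𝓝 0) := by
    filter_upwards [hfin] with ω hω
    have h1 : Tendsto (fun ε : ℝ ↦ ∫ y, Real.exp (-(ε / 2) * y ^ 2) * M ω y) (𝓝[>] 0)
        (𝓝 (∫ y, M ω y)) := by
      refine tendsto_integral_filter_of_dominated_convergence (M ω)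
        (.of_forall fun ε ↦ Measurable.aestronglyMeasurable (by fun_prop)) ?_ hω
        (.of_forall fun y ↦ ?_)
      · filter_upwards [self_mem_nhdsWithin] with ε hε
        refine .of_forall fun y ↦ ?_
        rw [norm_mul, Real.norm_of_nonneg (Real.exp_pos _).le, Real.norm_of_nonneg (hM0 ω y)]
        refine mul_le_of_le_one_left (hM0 ω y) ?_
        rw [Real.exp_le_one_iff]
        nlinarith [sq_nonneg y, mul_nonneg (Set.mem_Ioi.1 hε).le (sq_nonneg y)]
      · have : Continuous fun ε : ℝ ↦ Real.exp (-(ε / 2) * y ^ 2) * M ω y := by fun_prop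
        simpa using (this.tendsto 0).mono_left nhdsWithin_le_nhds
    have h2 : Tendsto (fun ε ↦ (J ε - I) ω) (𝓝[>] 0) (𝓝 0) := by
      have h3 := (h1.const_mul c).sub_const (I ω)
      simp only [hI, sub_self] at h3
      refine h3.congr' ?_
      filter_upwards [self_mem_nhdsWithin] with ε hε
      rw [Pi.sub_apply, hJ hε]
    have h4 := ENNReal.Tendsto.pow (n := 2) h2.enorm
    simpa using h4
  refine ⟨I, ⟨hIm.aestronglyMeasurable, ?_⟩, ?_⟩
  · rw [eLpNorm_lt_top_iff_lintegral_rpow_enorm_lt_top (by norm_num) (by norm_num)]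
    simp only [ENNReal.toReal_ofNat, ENNReal.rpow_two]
    exact (lintegral_mono fun ω ↦ pow_le_pow_left₀ zero_le (hIG ω) 2).trans_lt hbound
  · have h5 := tendsto_lintegral_filter_of_dominated_convergence (μ := μ) (l := 𝓝[>] (0 : ℝ))
      (F := fun ε ω ↦ ‖(J ε - I) ω‖ₑ ^ 2) (f := fun _ ↦ 0) (fun ω ↦ (‖c‖ₑ * G ω) ^ 2)
      (.of_forall fun ε ↦ (((hJm ε).sub hIm).enorm.pow_const 2))
      (by filter_upwards [self_mem_nhdsWithin] with ε hε using hJI hε) hbound.ne hlim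
    rw [lintegral_zero] at h5
    have h6 := (ENNReal.continuous_rpow_const (y := (1 / 2 : ℝ))).tendsto 0 |>.comp h5
    rw [ENNReal.zero_rpow_of_pos (by norm_num)] at h6
    refine h6.congr fun ε ↦ ?_
    rw [eLpNorm_eq_lintegral_rpow_enorm_toReal (by norm_num) (by norm_num)]
    simp

end Convergence

/-! ### Application to the Brownian bridge -/

section BrownianBridge

variable {Ω : Type*} [MeasurableSpace Ω] {μ : Measure Ω} {T : ℝ} {B : ℝ → Ω → ℝ}

/-- The fifth time T carries the bridge correction: its coefficient collects the terms -(t/T) B_T of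
the four bridge values. -/
theorem sum_mul_min_eq_bridgeVariance {T t₁ t₂ t₃ t₄ : ℝ} (hT : 0 < T)
    (h₁ : t₁ ≤ T) (h₂ : t₂ ≤ T) (h₃ : t₃ ≤ T) (h₄ : t₄ ≤ T) :
    let w : Fin 5 → ℝ := ![t₁, t₂, t₃, t₄, T]
    let c : Fin 5 → ℝ := ![1, -1, 1, -1, -((t₁ - t₂ + t₃ - t₄) / T)]
    ∑ i, ∑ j, c i * c j * min (w i) (w j) = bridgeVariance T t₁ t₂ t₃ t₄ := by
  intro w c
  simp only [w, c, Fin.sum_univ_five, Matrix.cons_val, min_self, min_eq_left h₁, min_eq_left h₂,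
    min_eq_left h₃, min_eq_left h₄, min_eq_right h₁, min_eq_right h₂, min_eq_right h₃,
    min_eq_right h₄]
  have hmin (s t : ℝ) : min s t = (s + t - |s - t|) / 2 := by
    rw [← max_sub_min_eq_abs', ← min_add_max s t]
    ring
  simp only [hmin, abs_sub_comm t₂ t₁, abs_sub_comm t₃ t₁, abs_sub_comm t₄ t₁, abs_sub_comm t₄ t₂,
    abs_sub_comm t₂ t₃, abs_sub_comm t₄ t₃, bridgeVariance]
  field_simp
  ring

theorem IsBrownianMotionOn.norm_integral_cexp_brownianBridge [IsProbabilityMeasure μ]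
    (hB : IsBrownianMotionOn T B μ) (hT : 0 < T) (a b y : ℝ) {t₁ t₂ t₃ t₄ : ℝ}
    (h₁ : t₁ ∈ Set.Icc 0 T) (h₂ : t₂ ∈ Set.Icc 0 T) (h₃ : t₃ ∈ Set.Icc 0 T)
    (h₄ : t₄ ∈ Set.Icc 0 T) :
    ‖∫ ω, Complex.exp ((y * (brownianBridge T a b B t₁ ω - brownianBridge T a b B t₂ ω +
      brownianBridge T a b B t₃ ω - brownianBridge T a b B t₄ ω) : ℝ) * Complex.I) ∂μ‖ =
      Real.exp (-(2 * (y ^ 2 / 4) * bridgeVariance T t₁ t₂ t₃ t₄)) := by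
  let w : Fin 5 → ℝ≥0 := ![⟨t₁, h₁.1⟩, ⟨t₂, h₂.1⟩, ⟨t₃, h₃.1⟩, ⟨t₄, h₄.1⟩, ⟨T, hT.le⟩]
  let c : Fin 5 → ℝ := ![1, -1, 1, -1, -((t₁ - t₂ + t₃ - t₄) / T)]
  have hwc (i : Fin 5) : (w i : ℝ) = (![t₁, t₂, t₃, t₄, T] : Fin 5 → ℝ) i := by
    fin_cases i <;> rfl
  have hw (i : Fin 5) : (w i : ℝ) ≤ T := by
    rw [hwc]
    fin_cases i
    exacts [h₁.2, h₂.2, h₃.2, h₄.2, le_rfl]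
  -- The four signs sum to zero, so the affine drift reduces to (b - a)(t₁ - t₂ + t₃ - t₄)/T.
  have h := hB.norm_integral_cexp w hw c ((b - a) * ((t₁ - t₂ + t₃ - t₄) / T)) y
  simp_rw [hwc] at h
  rw [sum_mul_min_eq_bridgeVariance hT h₁.2 h₂.2 h₃.2 h₄.2] at h
  convert h using 7 with ω
  · simp only [Fin.sum_univ_five, c, Matrix.cons_val, brownianBridge]
    ring
  · ring

theorem heatKernel_nonneg (ε x : ℝ) : 0 ≤ heatKernel ε x := by
  unfold heatKernel
  positivity

theorem heatKernel_le {ε : ℝ} (hε : 0 < ε) (x : ℝ) :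
    heatKernel ε x ≤ 1 / √(2 * Real.pi * ε) := by
  refine mul_le_of_le_one_right (by positivity) ?_
  rw [Real.exp_le_one_iff]
  exact div_nonpos_of_nonpos_of_nonneg (by nlinarith [sq_nonneg x]) (by positivity)

theorem integrable_heatKernel_sub {ν : Measure ℝ} [IsFiniteMeasure ν] {ε : ℝ} (hε : 0 < ε)
    {f : ℝ → ℝ} (hf : Measurable f) :
    Integrable (fun p : ℝ × ℝ ↦ heatKernel ε (f p.1 - f p.2)) (ν.prod ν) := by
  refine Integrable.of_bound
    ((continuous_heatKernel ε).measurable.comp (by fun_prop)).aestronglyMeasurable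
    (1 / √(2 * Real.pi * ε)) (.of_forall fun p ↦ ?_)
  rw [Real.norm_of_nonneg (heatKernel_nonneg _ _)]
  exact heatKernel_le hε _

theorem intervalIntegral_heatKernel_eq_half {ε : ℝ} (hT : 0 ≤ T) (hε : 0 < ε) {x f : ℝ → ℝ}
    (hf : Measurable f) (hx : ∀ t ∈ Set.Icc 0 T, f t = x t) :
    ∫ t in (0 : ℝ)..T, ∫ s in (0 : ℝ)..t, heatKernel ε (x t - x s) =
      2⁻¹ * ∫ p, heatKernel ε (f p.1 - f p.2)
        ∂(volume.restrict (Set.Icc 0 T)).prod (volume.restrict (Set.Icc 0 T)) := by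
  rw [← integral_triangle_eq_half hT (h := fun t s ↦ heatKernel ε (f t - f s))
    (fun s t ↦ by rw [← heatKernel_neg, neg_sub]) (integrable_heatKernel_sub hε hf)]
  refine intervalIntegral.integral_congr fun t ht ↦ intervalIntegral.integral_congr fun s hs ↦ ?_
  rw [Set.uIcc_of_le hT] at ht
  rw [Set.uIcc_of_le ht.1] at hs
  simp only [hx t ht, hx s ⟨hs.1, hs.2.trans ht.2⟩]

end BrownianBridge

theorem mainTheorem3 {Ω : Type*} [MeasurableSpace Ω] (μ : Measure Ω) [IsProbabilityMeasure μ]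
    (T : ℝ) (hT : 0 < T) (a b : ℝ) (B : ℝ → Ω → ℝ) (hB : IsBrownianMotionOn T B μ) :
    (∀ ε : ℝ, 0 < ε →
      MemLp (approxSelfIntersectionLocalTime T (brownianBridge T a b B) ε) 2 μ) ∧
    ∃ I : Ω → ℝ, MemLp I 2 μ ∧
      Tendsto
        (fun ε : ℝ ↦
          eLpNorm (approxSelfIntersectionLocalTime T (brownianBridge T a b B) ε - I) 2 μ)
        (𝓝[>] 0) (𝓝 0) := by

  set ν := volume.restrict (Set.Icc 0 T) with hν
  -- Joint measurability, needed for Fubini, comes from a modification that agrees with `B` on all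
  -- of [0, T] at once, so path integrals are almost surely unchanged.
  obtain ⟨W, hWm, hW⟩ := exists_measurable_modification (μ := μ) (T := T) (B := B)
    (fun t ht ↦ (hB.hasGaussianLaw_eval ⟨t, ht.1⟩ ht.2).aemeasurable) hB.continuousOn
  set Z : Ω × ℝ → ℝ := fun q ↦
    a * (1 - q.2 / T) + b * (q.2 / T) + W q - q.2 / T * W (q.1, T) with hZdef
  have hZ : Measurable Z := by fun_prop
  have hZB : ∀ᵐ ω ∂μ, ∀ t ∈ Set.Icc 0 T, Z (ω, t) = brownianBridge T a b B t ω := by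
    filter_upwards [hW] with ω hω t ht
    simp only [hZdef, brownianBridge, hω t ht, hω T ⟨hT.le, le_rfl⟩]
  have hpair : HasPairingBound μ T Z := by
    intro y t₁ h₁ t₂ h₂ t₃ h₃ t₄ h₄
    refine le_of_eq_of_le ?_ (exp_neg_bridgeVariance_le hT (by positivity) h₁ h₂ h₃ h₄)
    rw [← hB.norm_integral_cexp_brownianBridge hT a b y h₁ h₂ h₃ h₄]
    congr 1
    refine integral_congr_ae ?_
    filter_upwards [hZB] with ω hω
    rw [hω _ h₁, hω _ h₂, hω _ h₃, hω _ h₄]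
  have hJ {ε : ℝ} (hε : 0 < ε) :
      approxSelfIntersectionLocalTime T (brownianBridge T a b B) ε =ᵐ[μ]
        fun ω ↦ 2⁻¹ * ∫ p, heatKernel ε (Z (ω, p.1) - Z (ω, p.2)) ∂ν.prod ν := by
    filter_upwards [hZB] with ω hω
    exact intervalIntegral_heatKernel_eq_half (f := fun t ↦ Z (ω, t)) hT.le hε (by fun_prop) hω
  refine ⟨fun ε hε ↦ ?_, ?_⟩
  · rw [memLp_congr_ae (hJ hε)]
    have hm : Measurable fun ω ↦ ∫ p, heatKernel ε (Z (ω, p.1) - Z (ω, p.2)) ∂ν.prod ν := by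
      refine StronglyMeasurable.measurable (StronglyMeasurable.integral_prod_right
        (f := fun (ω : Ω) (p : ℝ × ℝ) ↦ heatKernel ε (Z (ω, p.1) - Z (ω, p.2))) ?_)
      exact ((continuous_heatKernel ε).measurable.comp (by fun_prop)).stronglyMeasurable
    refine (MemLp.of_bound hm.aestronglyMeasurable
      (1 / √(2 * Real.pi * ε) * (ν.prod ν).real Set.univ) (.of_forall fun ω ↦ ?_)).const_mul _
    refine norm_integral_le_of_norm_le_const (.of_forall fun p ↦ ?_)
    rw [Real.norm_of_nonneg (heatKernel_nonneg _ _)]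
    exact heatKernel_le hε _
  · obtain ⟨I, hI, hlim⟩ := exists_tendsto_eLpNorm_integral_heatKernel hT.le hZ hpair
    refine ⟨I, hI, hlim.congr' ?_⟩
    filter_upwards [self_mem_nhdsWithin] with ε hε
    exact eLpNorm_congr_ae ((hJ hε).symm.sub .rfl)
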